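/- **Setting.** Let $p\in(1,\infty)$, $c\in(1,2]$, and let $(G,d)$ be a complete $p$-uniformly convex space with constant $c$: a geodesic space with $$d(z,(1-t)x\oplus ty)^p\le (1-t)d(z,x)^p+t\,d(z,y)^p-\tfrac c2 t(1-t)d(x,y)^p\quad(t\in[0,1],\ x,y,z\in G).$$ Let $f,g:G\to\mathbb R\cup\{+\infty\}$ be proper, (geodesically) convex and lower semicontinuous with $\operatorname{argmin} f\cap\operatorname{argmin} g\neq\emptyset$. For $\lambda>0$ let $\operatorname{prox}^p_{f,\lambda}(x)=\operatorname{argmin}_{y\in G}\, f(y)+\frac1{p\lambda^{p-1}}d(y,x)^p$, and for $\beta\in(0,1]$ let $\beta T\oplus(1-\beta)\mathrm{Id}$ map $x$ to $\beta Tx\oplus(1-\beta)x$. For $T:G\to G$ and $r>0$ put $$\psi_T^{(p,r)}(x,y)=\tfrac r2\big(d(Tx,x)^p+d(Ty,y)^p+d(Tx,Ty)^p+d(x,y)^p-d(Tx,y)^p-d(x,Ty)^p\big),$$ and consider, for $\alpha\in(0,1)$ and $\epsilon\ge0$, the inequality $$(*)\qquad d(Tx,Ty)^p\le(1+\epsilon)d(x,y)^p-\tfrac{1-\alpha}{\alpha}\psi^{(p,r)}_T(x,y).$$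 $T$ is *pointwise almost $\alpha$-firmly nonexpansive at $y\in D$ on $D\subset G$ with constant $\alpha\in(0,1)$ and violation $\epsilon\ge 0$* if $(*)$ with $r=c$ holds for all $x\in D$. $T$ is *pointwise asymptotically $\alpha$-firmly nonexpansive at $y$ with constant $\alpha\in(0,1)$, with respect to $r$* if for every $\epsilon>0$ there is a neighborhood $D_\epsilon$ of $y$ such that $(*)$ holds for all $x\in D_\epsilon$; when $r$ is not mentioned, $r=c$. A space is *symmetric perpendicular* if for all geodesics $\gamma,\eta$ with a common point $q$: $\gamma\perp_q\eta\iff\eta\perp_q\gamma$, where $\gamma\perp_q\eta$ means $d(x,q)\le d(x,y)$ for all $x\in\gamma$, $y\in\eta$. Put $$\alpha_c=\tfrac{c(c-1)}{c(c-1)+2},\qquad \epsilon_c=\tfrac{2-c}{c-1},\qquad \alpha_\beta=\tfrac{\alpha_c\beta^{p-1}}{\alpha_c\beta^{p-1}-\alpha_c\beta+1},\qquad \overline\alpha_\beta=\tfrac{\beta^{p-1}}{\beta^{p-1}-\beta+2},$$ $$A(a,b)=\frac{a+b-2ab}{\frac c2(1-a-b+ab)+a+b-2ab}.$$ The statements about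 CAT($\kappa$) spaces ($\kappa>0$) are for the exponent $p=2$, and there $r$ is an arbitrary number in $(0,2]$ (in particular $r=c$ and $r=2$ are allowed). **Proposition.** Let $\lambda,\lambda_1,\lambda_2>0$ and $\beta\in(0,1]$. 1. $T=\operatorname{prox}^p_{f,\lambda_2}\circ\operatorname{prox}^p_{g,\lambda_1}$ is pointwise almost $\alpha$-firmly nonexpansive at all $y\in\operatorname{argmin} f\cap\operatorname{argmin} g$ on $G$ with constant $\frac{2(c-1)}{2c-1}$ and violation $\frac1{(c-1)^2}-1$. If $(G,d)$ is a CAT($\kappa$) space, $T$ is pointwise asymptotically $\alpha$-firmly nonexpansive at all these $y$ with constant $\frac23$, with respect to $r$. 2. Let $T_0:G\to G$, let $\Omega=\operatorname{argmin} f\cap\operatorname{Fix}T_0$, and let $T_0$ be pointwise asymptotically $\alpha$-firmly nonexpansive with constant $\overline\alpha_0$ at all $y\in\Omega$. Let $T=\operatorname{prox}^p_{f,\lambda}\circ T_0$ and $y\in\Omega$. If $T_0$ is pointwise almost $\alpha$-firmly nonexpansive at $y$ on a set $D\subset G$ with constant $\overline\alpha_0$ and violation $\epsilon_0$, then $T$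 is pointwise almost $\alpha$-firmly nonexpansive at $y$ on $D$ with constant $A(\overline\alpha_0,\alpha_c)$ and violation $\epsilon_0+\epsilon_c+\epsilon_0\epsilon_c$; and for every $\epsilon_0>0$ there is a neighborhood $D$ of $y$ on which both hold. If $(G,d)$ is a CAT($\kappa$) space and $T_0$ is pointwise asymptotically $\alpha$-firmly nonexpansive at all $y\in\Omega$ with constant $\overline\alpha_0$, with respect to $r$, then $T$ is so at all $y\in\Omega$ with constant $\frac1{2-\overline\alpha_0}$, with respect to $r$. 3. $T=\beta\operatorname{prox}^p_{f,\lambda}\oplus(1-\beta)\mathrm{Id}$ is pointwise almost $\alpha$-firmly nonexpansive at all $y\in\operatorname{argmin} f$ on $G$ with constant $\alpha_\beta$ and violation $\beta\epsilon_c$. If $(G,d)$ is a CAT($\kappa$) space, $T$ is pointwise asymptotically $\alpha$-firmly nonexpansive at all these $y$ with constant $\overline\alpha_\beta$, with respect to $r$. 4. $T=\operatorname{prox}^p_{f,\lambda_2}\circ(\beta\operatorname{prox}^p_{g,\lambda_1}\oplus(1-\beta)\mathrm{Id})$ is pointwise almost $\alpha$-firmly nonexpansive at all $y\in\operatorname{argmin}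 f\cap\operatorname{argmin} g$ on $G$ with constant $A(\alpha_\beta,\alpha_c)$ and violation $(1+\beta)\epsilon_c+\beta\epsilon_c^2$. If $(G,d)$ is a CAT($\kappa$) space, $T$ is pointwise asymptotically $\alpha$-firmly nonexpansive at all these $y$ with constant $\frac1{2-\overline\alpha_\beta}$, with respect to $r$. 5. Let $C\subset G$ be closed and geodesically convex with metric projector $P_C$, and let $T=P_C\circ(\beta\operatorname{prox}^p_{g,\lambda}\oplus(1-\beta)\mathrm{Id})$. If $(G,d)$ is symmetric perpendicular, then $T$ is pointwise almost $\alpha$-firmly nonexpansive at all $y\in C\cap\operatorname{argmin} g$ on $G$ with constant $\frac1{\frac c2(1-\alpha_\beta)+1}$ and violation $\beta\epsilon_c$. If $(G,d)$ is a CAT($\kappa$) space, $T$ is pointwise asymptotically $\alpha$-firmly nonexpansive at all these $y$ with constant $\frac1{2-\overline\alpha_\beta}$, with respect to $r$. -/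

import Mathlib

open Set Filter Topology

noncomputable section

namespace ProxFirm

variable {G : Type*} [MetricSpace G]

/-- `γ`, restricted to `[0,1]`, is a geodesic from `x` to `y` (parametrised proportionally to
arc length). -/
def IsGeodesic (γ : ℝ → G) (x y : G) : Prop :=
  γ 0 = x ∧ γ 1 = y ∧
    ∀ s ∈ Icc (0 : ℝ) 1, ∀ t ∈ Icc (0 : ℝ) 1, dist (γ s) (γ t) = |s - t| * dist x y

/-- Any two points are joined by a geodesic. -/
def IsGeodesicSpace (G : Type*) [MetricSpace G] : Prop :=
  ∀ x y : G, ∃ γ : ℝ → G, IsGeodesic γ x y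

/-- `p`-uniformly convex spaces with constant `c`. The points `(1-t)x ⊕ ty` are the points `γ t`
of the geodesics `γ` from `x` to `y`. -/
def IsPUniformlyConvex (p c : ℝ) (G : Type*) [MetricSpace G] : Prop :=
  1 < p ∧ 0 < c ∧ IsGeodesicSpace G ∧
    ∀ (x y z : G) (γ : ℝ → G), IsGeodesic γ x y → ∀ t ∈ Icc (0 : ℝ) 1,
      dist z (γ t) ^ p ≤
        (1 - t) * dist z x ^ p + t * dist z y ^ p - c / 2 * (t * (1 - t)) * dist x y ^ p

open Classical in
/-- The geodesic convex combination `(1-t)x ⊕ ty`. In a `p`-uniformly convex space geodesics exist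
and are unique, so no choice is involved there. -/
def geoComb (t : ℝ) (x y : G) : G :=
  if h : ∃ γ : ℝ → G, IsGeodesic γ x y then h.choose t else x

/-! ### CAT(κ) spaces, `κ > 0` -/

/-- The unit sphere in Euclidean 3-space. With the angular distance divided by `√κ`, it is the
model surface of constant curvature `κ > 0`. -/
abbrev Sph : Type := Metric.sphere (0 : EuclideanSpace ℝ (Fin 3)) 1

/-- Distance of the model surface of curvature `κ > 0`. -/
def modelDist (κ : ℝ) (u v : Sph) : ℝ :=
  InnerProductGeometry.angle (u : EuclideanSpace ℝ (Fin 3)) (v : EuclideanSpace ℝ (Fin 3)) /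
    Real.sqrt κ

/-- CAT(κ) spaces for `κ > 0`: points at distance less than `π / √κ` are joined by a geodesic, and
every geodesic triangle of perimeter less than `2π / √κ` has a comparison triangle `x' y' z'` in
the model surface such that distances between points of the triangle do not exceed those
between their comparison points. (Two points on different sides of the triangle are on two sides
with a common vertex, here called `x`.) -/
def IsCAT (κ : ℝ) (G : Type*) [MetricSpace G] : Prop :=
  0 < κ ∧
  (∀ x y : G, dist x y < Real.pi / Real.sqrt κ → ∃ γ : ℝ → G, IsGeodesic γ x y) ∧
  ∀ (x y z : G) (γ η : ℝ → G), IsGeodesic γ x y → IsGeodesic η x z →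
    dist x y + dist y z + dist z x < 2 * Real.pi / Real.sqrt κ →
    ∃ x' y' z' : Sph,
      modelDist κ x' y' = dist x y ∧ modelDist κ y' z' = dist y z ∧
      modelDist κ x' z' = dist x z ∧
      ∀ s ∈ Icc (0 : ℝ) 1, ∀ t ∈ Icc (0 : ℝ) 1, ∀ u v : Sph,
        modelDist κ x' u = s * dist x y → modelDist κ u y' = (1 - s) * dist x y →
        modelDist κ x' v = t * dist x z → modelDist κ v z' = (1 - t) * dist x z →
        dist (γ s) (η t) ≤ modelDist κ u v

/-! ### Symmetric perpendicular spaces -/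

/-- Images of geodesics. -/
def IsGeodesicSet (S : Set G) : Prop :=
  ∃ (x y : G) (γ : ℝ → G), IsGeodesic γ x y ∧ S = γ '' Icc (0 : ℝ) 1

/-- `S` is perpendicular to `R` at the point `q`. -/
def Perp (S R : Set G) (q : G) : Prop :=
  ∀ x ∈ S, ∀ y ∈ R, dist x q ≤ dist x y

/-- Symmetric perpendicular spaces. -/
def IsSymmPerp (G : Type*) [MetricSpace G] : Prop :=
  ∀ (S R : Set G), IsGeodesicSet S → IsGeodesicSet R →
    ∀ q ∈ S ∩ R, (Perp S R q ↔ Perp R S q)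

/-! ### Convex functions, convex sets, proximal mappings and projectors -/

/-- Proper convex lower semicontinuous functions `G → ℝ ∪ {+∞}`. -/
def IsProperConvexLsc (f : G → EReal) : Prop :=
  (∀ x, f x ≠ ⊥) ∧ (∃ x, f x ≠ ⊤) ∧ LowerSemicontinuous f ∧
    ∀ (x y : G) (γ : ℝ → G), IsGeodesic γ x y → ∀ t ∈ Icc (0 : ℝ) 1,
      f (γ t) ≤ ((1 - t : ℝ) : EReal) * f x + (t : EReal) * f y

/-- The set of (global) minimisers of `f`. -/
def argmin (f : G → EReal) : Set G := {x | ∀ y, f x ≤ f y}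

/-- The function `y ↦ f y + d(y,x)^p / (p l^(p-1))` that defines the `p`-proximal mapping. -/
def proxObj (p l : ℝ) (f : G → EReal) (x y : G) : EReal :=
  f y + ((1 / (p * l ^ (p - 1)) * dist y x ^ p : ℝ) : EReal)

open Classical in
/-- The `p`-proximal mapping. In a complete `p`-uniformly convex space the minimiser exists and is
unique for a proper convex lower semicontinuous function that has a minimiser, so the choice and
the default value are immaterial there. -/
def prox (p l : ℝ) (f : G → EReal) (x : G) : G :=
  if h : ∃ z, z ∈ argmin (proxObj p l f x) then h.choose else x

/-- Geodesically convex sets. -/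
def IsGeodConvex (C : Set G) : Prop :=
  ∀ x ∈ C, ∀ y ∈ C, ∀ γ : ℝ → G, IsGeodesic γ x y → ∀ t ∈ Icc (0 : ℝ) 1, γ t ∈ C

open Classical in
/-- The metric projector onto `C`. In a complete `p`-uniformly convex space the nearest point exists
and is unique for a nonempty closed convex set. -/
def proj (C : Set G) (x : G) : G :=
  if h : ∃ z ∈ C, ∀ w ∈ C, dist x z ≤ dist x w then h.choose else x

/-- The Krasnoselski-Mann relaxation `βT ⊕ (1-β)Id`. -/
def km (β : ℝ) (T : G → G) (x : G) : G := geoComb β x (T x)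

/-! ### Almost α-firm nonexpansiveness -/

/-- The transport discrepancy. -/
def psi (p c : ℝ) (T : G → G) (x y : G) : ℝ :=
  c / 2 * (dist (T x) x ^ p + dist (T y) y ^ p + dist (T x) (T y) ^ p + dist x y ^ p
    - dist (T x) y ^ p - dist x (T y) ^ p)

/-- The inequality of almost α-firm nonexpansiveness for a pair of points. -/
def FirmIneq (p c : ℝ) (T : G → G) (α ε : ℝ) (x y : G) : Prop :=
  dist (T x) (T y) ^ p ≤ (1 + ε) * dist x y ^ p - (1 - α) / α * psi p c T x y

/-- `T` is pointwise almost α-firmly nonexpansive at `y ∈ D` on `D` with constant `α` and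
violation `ε`. -/
def AlmostFirmAt (p c : ℝ) (T : G → G) (D : Set G) (y : G) (α ε : ℝ) : Prop :=
  0 < α ∧ α < 1 ∧ 0 ≤ ε ∧ y ∈ D ∧ ∀ x ∈ D, FirmIneq p c T α ε x y

/-- `T` is pointwise asymptotically α-firmly nonexpansive at `y` with constant `α`. -/
def AsympFirmAt (p c : ℝ) (T : G → G) (y : G) (α : ℝ) : Prop :=
  0 < α ∧ α < 1 ∧ ∀ ε > 0, ∃ D ∈ 𝓝 y, ∀ x ∈ D, FirmIneq p c T α ε x y

/-! ### The constants -/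

/-- `α_c` -/
def alphaC (c : ℝ) : ℝ := c * (c - 1) / (c * (c - 1) + 2)

/-- `ε_c` -/
def epsC (c : ℝ) : ℝ := (2 - c) / (c - 1)

/-- The constant of a composition of two mappings with constants `a` and `b`. -/
def alphaComp (c a b : ℝ) : ℝ :=
  (a + b - 2 * a * b) / (c / 2 * (1 - a - b + a * b) + a + b - 2 * a * b)

/-- `α_β` -/
def alphaKM (p c β : ℝ) : ℝ :=
  alphaC c * β ^ (p - 1) / (alphaC c * β ^ (p - 1) - alphaC c * β + 1)

/-- The asymptotic constant of the Krasnoselski-Mann relaxation of a proximal mapping. -/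
def alphaKMAsymp (p β : ℝ) : ℝ := β ^ (p - 1) / (β ^ (p - 1) - β + 2)

end ProxFirm

end

namespace ProxFirm

variable {G : Type*} [MetricSpace G]

/-! ### Elementary facts on geodesics and uniform convexity -/

/-! Let `y` minimise `f` and let `u` be the proximal point of `x`. Moving from `u` towards `y` does
not increase `f`, so minimality of `u` forces `u` to be nearest to `x` on the geodesic from `u` to
`y`; a projector has the same property for `y ∈ C`. Only this property, `IsNearestAlong`, is used
afterwards. Uniform convexity along that geodesic, to first order at `u`, gives `d(x,u)^p + (c/2)
d(u,y)^p ≤ d(x,y)^p` (`IsNearestAlong.rpow_add_le`).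

At a fixed point `y` the transport discrepancy is just `(r/2) d(Tx,x)^p`, so firmness compares three
distances. Dividing the inequality above by `c - 1` yields `alphaC` and `epsC`. Compositions add the
gains of both steps and merge them by uniform convexity (`AlmostFirmAt.comp`); relaxations apply
uniform convexity between `x` and `Tx` (`AlmostFirmAt.km`).

In a CAT(κ) space, spherical comparison gives the CAT(0) inequality up to an arbitrarily small
multiple of the squared side lengths of small triangles (`IsCAT.exists_sq_dist_le`). The same
arguments then run near `y` as if `c = 2`, at the price of an arbitrarily small violation. -/

theorem IsGeodesic.dist_left {γ : ℝ → G} {x y : G} (h : IsGeodesic γ x y) {t : ℝ}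
    (ht : t ∈ Icc (0 : ℝ) 1) : dist (γ t) x = t * dist x y := by
  have := h.2.2 t ht 0 ⟨le_rfl, zero_le_one⟩
  rwa [h.1, sub_zero, abs_of_nonneg ht.1] at this

theorem IsGeodesic.dist_right {γ : ℝ → G} {x y : G} (h : IsGeodesic γ x y) {t : ℝ}
    (ht : t ∈ Icc (0 : ℝ) 1) : dist (γ t) y = (1 - t) * dist x y := by
  have := h.2.2 t ht 1 ⟨zero_le_one, le_rfl⟩
  rwa [h.2.1, abs_sub_comm, abs_of_nonneg (sub_nonneg.2 ht.2)] at this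

theorem geoComb_spec (hG : IsGeodesicSpace G) (t : ℝ) (x y : G) :
    ∃ γ : ℝ → G, IsGeodesic γ x y ∧ geoComb t x y = γ t := by
  have h := hG x y
  exact ⟨h.choose, h.choose_spec, by rw [geoComb, dif_pos h]⟩

/-- Performs the passage `t → 0` once a geodesic inequality has been divided by `t`. -/
theorem le_of_forall_one_sub_mul_le {X Y : ℝ} (h : ∀ t ∈ Ioo (0 : ℝ) 1, (1 - t) * Y ≤ X) :
    Y ≤ X := by
  have ht : Tendsto (fun t : ℝ => (1 - t) * Y) (𝓝[>] 0) (𝓝 Y) := by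
    have : Continuous fun t : ℝ => (1 - t) * Y := by fun_prop
    simpa using (this.tendsto 0).mono_left nhdsWithin_le_nhds
  exact le_of_tendsto ht (by filter_upwards [Ioo_mem_nhdsGT one_pos] with t ht using h t ht)

/-! ### Existence of minimisers -/

/-- A function on a complete space that is bounded below, has closed sublevel sets, and is
uniformly midpoint convex, attains its minimum. -/
theorem exists_minimizer_of_midpoint [CompleteSpace G] {p k : ℝ} (hp : 0 < p) (hk : 0 < k)
    {A : Set G} {φ : G → ℝ} (hA : A.Nonempty) (hb : ∃ m, ∀ z ∈ A, m ≤ φ z)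
    (hcl : ∀ a, IsClosed {z | z ∈ A ∧ φ z ≤ a})
    (hmid : ∀ u ∈ A, ∀ v ∈ A, ∃ w ∈ A, φ w ≤ (φ u + φ v) / 2 - k * dist u v ^ p) :
    ∃ z ∈ A, ∀ w ∈ A, φ z ≤ φ w := by
  obtain ⟨m, hm⟩ := hb
  have hbdd : BddBelow (φ '' A) := ⟨m, by rintro _ ⟨z, hz, rfl⟩; exact hm z hz⟩
  set I := sInf (φ '' A) with hI
  have hIle : ∀ w ∈ A, I ≤ φ w := fun w hw => csInf_le hbdd ⟨w, hw, rfl⟩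
  have hseq : ∀ n : ℕ, ∃ z ∈ A, φ z < I + 1 / ((n : ℝ) + 1) := fun n => by
    have : I < I + 1 / ((n : ℝ) + 1) := by
      have : (0 : ℝ) < 1 / ((n : ℝ) + 1) := by positivity
      linarith
    obtain ⟨_, ⟨z, hz, rfl⟩, hlt⟩ := exists_lt_of_csInf_lt (hA.image φ) this
    exact ⟨z, hz, hlt⟩
  choose z hzA hz using hseq
  have hlim := tendsto_one_div_add_atTop_nhds_zero_nat (𝕜 := ℝ)
  have hle : ∀ N n : ℕ, N ≤ n → φ (z n) ≤ I + 1 / ((N : ℝ) + 1) := fun N n h => by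
    have h1 : 1 / ((n : ℝ) + 1) ≤ 1 / ((N : ℝ) + 1) := by
      have : (N : ℝ) ≤ n := by exact_mod_cast h
      gcongr
    linarith [(hz n).le]
  have hcau : CauchySeq z := by
    rw [Metric.cauchySeq_iff]
    intro ε hε
    have hpos : 0 < k * ε ^ p := by positivity
    obtain ⟨N, hN⟩ := (hlim.eventually (gt_mem_nhds hpos)).exists
    refine ⟨N, fun i hi j hj => ?_⟩
    obtain ⟨w, hwA, hw⟩ := hmid _ (hzA i) _ (hzA j)
    -- The midpoint value is at least the infimum `I`, while both end values exceed `I` by at most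
    -- `1 / (N + 1)`.
    have h1 : k * dist (z i) (z j) ^ p < k * ε ^ p := by
      linarith [hIle w hwA, hle N i hi, hle N j hj]
    have h2 := lt_of_mul_lt_mul_left h1 hk.le
    exact (Real.rpow_lt_rpow_iff dist_nonneg hε.le hp).1 h2
  obtain ⟨x, hx⟩ := cauchySeq_tendsto_of_complete hcau
  have hmem : ∀ N : ℕ, x ∈ A ∧ φ x ≤ I + 1 / ((N : ℝ) + 1) := fun N =>
    (hcl _).mem_of_tendsto hx (eventually_atTop.2 ⟨N, fun n hn => ⟨hzA n, hle N n hn⟩⟩)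
  have hxI : φ x ≤ I := by
    have : Tendsto (fun N : ℕ => I + 1 / ((N : ℝ) + 1)) atTop (𝓝 I) := by
      simpa using hlim.const_add I
    exact ge_of_tendsto' this fun N => (hmem N).2
  exact ⟨x, (hmem 0).1, fun w hw => hxI.trans (hIle w hw)⟩

theorem IsPUniformlyConvex.midpoint {p c : ℝ} (hG : IsPUniformlyConvex p c G) {u v : G}
    {γ : ℝ → G} (hγ : IsGeodesic γ u v) (x : G) :
    dist x (γ (1 / 2)) ^ p ≤ (dist x u ^ p + dist x v ^ p) / 2 - c / 8 * dist u v ^ p := by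
  have := hG.2.2.2 u v x γ hγ (1 / 2) ⟨by norm_num, by norm_num⟩
  linarith

theorem proj_spec [CompleteSpace G] {p c : ℝ} (hG : IsPUniformlyConvex p c G) {C : Set G}
    (hC : IsClosed C) (hconv : IsGeodConvex C) (hne : C.Nonempty) (x : G) :
    proj C x ∈ C ∧ ∀ w ∈ C, dist x (proj C x) ≤ dist x w := by
  have hp : 0 < p := one_pos.trans hG.1
  have h : ∃ z ∈ C, ∀ w ∈ C, dist x z ≤ dist x w := by
    obtain ⟨z, hz, hmin⟩ := exists_minimizer_of_midpoint (A := C) (φ := fun z => dist x z ^ p)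
      (k := c / 8) hp (by linarith [hG.2.1]) hne ⟨0, fun z _ => by positivity⟩
      (fun a => hC.inter (isClosed_le ((continuous_const.dist continuous_id).rpow_const
        fun _ => Or.inr hp.le) continuous_const))
      (fun u hu v hv => by
        obtain ⟨γ, hγ⟩ := hG.2.2.1 u v
        exact ⟨γ (1 / 2), hconv u hu v hv γ hγ _ ⟨by norm_num, by norm_num⟩, hG.midpoint hγ x⟩)
    exact ⟨z, hz, fun w hw => (Real.rpow_le_rpow_iff dist_nonneg dist_nonneg hp).1 (hmin w hw)⟩
  rw [proj, dif_pos h]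
  exact h.choose_spec

theorem IsProperConvexLsc.ne_top_of_mem_argmin {f : G → EReal} (hf : IsProperConvexLsc f) {y : G}
    (hy : y ∈ argmin f) : f y ≠ ⊤ := by
  obtain ⟨w, hw⟩ := hf.2.1
  exact fun h => hw (top_le_iff.1 (h ▸ hy w))

theorem IsProperConvexLsc.coe_toReal {f : G → EReal} (hf : IsProperConvexLsc f) {z : G}
    (hz : f z ≠ ⊤) : ((f z).toReal : EReal) = f z :=
  EReal.coe_toReal hz (hf.1 z)

theorem IsProperConvexLsc.toReal_geodesic_le {f : G → EReal} (hf : IsProperConvexLsc f)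
    {u v : G} (hu : f u ≠ ⊤) (hv : f v ≠ ⊤) {γ : ℝ → G} (hγ : IsGeodesic γ u v) {t : ℝ}
    (ht : t ∈ Icc (0 : ℝ) 1) :
    f (γ t) ≠ ⊤ ∧ (f (γ t)).toReal ≤ (1 - t) * (f u).toReal + t * (f v).toReal := by
  have h := hf.2.2.2 u v γ hγ t ht
  rw [← hf.coe_toReal hu, ← hf.coe_toReal hv, ← EReal.coe_mul, ← EReal.coe_mul,
    ← EReal.coe_add] at h
  have hne : f (γ t) ≠ ⊤ := fun h' =>
    EReal.coe_ne_top _ (top_le_iff.1 (h' ▸ h))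
  exact ⟨hne, by rwa [← hf.coe_toReal hne, EReal.coe_le_coe_iff] at h⟩

theorem IsProperConvexLsc.proxObj_eq {f : G → EReal} (hf : IsProperConvexLsc f) (p l : ℝ) (x : G)
    {z : G} (hz : f z ≠ ⊤) :
    proxObj p l f x z
      = (((f z).toReal + 1 / (p * l ^ (p - 1)) * dist z x ^ p : ℝ) : EReal) := by
  rw [proxObj, EReal.coe_add, hf.coe_toReal hz]

theorem proxObj_of_eq_top {f : G → EReal} (p l : ℝ) (x : G) {z : G} (hz : f z = ⊤) :
    proxObj p l f x z = ⊤ := by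
  rw [proxObj, hz, EReal.top_add_coe]

theorem IsProperConvexLsc.lowerSemicontinuous_proxObj {f : G → EReal} (hf : IsProperConvexLsc f)
    {p : ℝ} (hp : 0 ≤ p) (l : ℝ) (x : G) : LowerSemicontinuous (proxObj p l f x) := by
  refine hf.2.2.1.add' (Continuous.lowerSemicontinuous ?_) fun z => ?_
  · exact continuous_coe_real_ereal.comp (by fun_prop (disch := positivity))
  · exact EReal.continuousAt_add (Or.inr (EReal.coe_ne_bot _)) (Or.inr (EReal.coe_ne_top _))

theorem prox_mem_argmin [CompleteSpace G] {p c l : ℝ} (hG : IsPUniformlyConvex p c G) (hl : 0 < l)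
    {f : G → EReal} (hf : IsProperConvexLsc f) (hne : (argmin f).Nonempty) (x : G) :
    prox p l f x ∈ argmin (proxObj p l f x) := by
  have hp : 0 < p := one_pos.trans hG.1
  have hc := hG.2.1
  have hμ : 0 < 1 / (p * l ^ (p - 1)) := by positivity
  have h : ∃ z, z ∈ argmin (proxObj p l f x) := by
    obtain ⟨y, hy⟩ := hne
    have hytop := hf.ne_top_of_mem_argmin hy
    obtain ⟨z, hz, hmin⟩ := exists_minimizer_of_midpoint (A := {z | f z ≠ ⊤})
      (φ := fun z => (f z).toReal + 1 / (p * l ^ (p - 1)) * dist z x ^ p)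
      (k := 1 / (p * l ^ (p - 1)) * (c / 8)) hp (by positivity) ⟨y, hytop⟩
      ⟨(f y).toReal, fun z hz => by
        have h1 : (f y).toReal ≤ (f z).toReal := EReal.toReal_le_toReal (hy z) (hf.1 y) hz
        have h2 : 0 ≤ 1 / (p * l ^ (p - 1)) * dist z x ^ p := by positivity
        linarith⟩
      (fun a => by
        -- Sublevel sets of the real objective on the domain of `f` are those of the extended-valued
        -- one, which is lower semicontinuous.
        convert (hf.lowerSemicontinuous_proxObj hp.le l x).isClosed_preimage (a : EReal) using 1
        ext z
        by_cases hz : f z = ⊤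
        · simp [hz, proxObj_of_eq_top p l x hz]
        · rw [mem_preimage, hf.proxObj_eq p l x hz, mem_Iic, EReal.coe_le_coe_iff]
          exact and_iff_right hz)
      (fun u hu v hv => by
        obtain ⟨γ, hγ⟩ := hG.2.2.1 u v
        obtain ⟨h1, h2⟩ := hf.toReal_geodesic_le hu hv hγ (t := 1 / 2)
          ⟨by norm_num, by norm_num⟩
        refine ⟨γ (1 / 2), h1, ?_⟩
        have h3 := mul_le_mul_of_nonneg_left (hG.midpoint hγ x) hμ.le
        rw [dist_comm _ x, dist_comm u x, dist_comm v x]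
        linarith)
    refine ⟨z, fun w => ?_⟩
    by_cases hw : f w = ⊤
    · simp [proxObj_of_eq_top p l x hw]
    · rw [hf.proxObj_eq p l x hz, hf.proxObj_eq p l x hw, EReal.coe_le_coe_iff]
      exact hmin w hw
  rw [prox, dif_pos h]
  exact h.choose_spec

/-! ### Points that are nearest along geodesics -/

/-- `u` is a point of every geodesic from `u` to `y` that is nearest to `x`. -/
def IsNearestAlong (x u y : G) : Prop :=
  ∀ γ : ℝ → G, IsGeodesic γ u y → ∀ t ∈ Icc (0 : ℝ) 1, dist x u ≤ dist x (γ t)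

theorem isNearestAlong_proj [CompleteSpace G] {p c : ℝ} (hG : IsPUniformlyConvex p c G)
    {C : Set G} (hC : IsClosed C) (hconv : IsGeodConvex C) {y : G} (hy : y ∈ C) (x : G) :
    IsNearestAlong x (proj C x) y := by
  obtain ⟨h1, h2⟩ := proj_spec hG hC hconv ⟨y, hy⟩ x
  exact fun γ hγ t ht => h2 _ (hconv _ h1 y hy γ hγ t ht)

theorem isNearestAlong_prox [CompleteSpace G] {p c l : ℝ} (hG : IsPUniformlyConvex p c G)
    (hl : 0 < l) {f : G → EReal} (hf : IsProperConvexLsc f) {y : G} (hy : y ∈ argmin f) (x : G) :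
    IsNearestAlong x (prox p l f x) y := by
  have hp : 0 < p := one_pos.trans hG.1
  have hμ : 0 < 1 / (p * l ^ (p - 1)) := by positivity
  have hu := prox_mem_argmin hG hl hf ⟨y, hy⟩ x
  have hytop := hf.ne_top_of_mem_argmin hy
  set u := prox p l f x
  have hutop : f u ≠ ⊤ := fun h => by
    have := hu y
    rw [proxObj_of_eq_top p l x h, hf.proxObj_eq p l x hytop] at this
    exact EReal.coe_ne_top _ (top_le_iff.1 this)
  intro γ hγ t ht
  obtain ⟨h1, h2⟩ := hf.toReal_geodesic_le hutop hytop hγ ht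
  have h3 := hu (γ t)
  rw [hf.proxObj_eq p l x hutop, hf.proxObj_eq p l x h1, EReal.coe_le_coe_iff] at h3
  have h4 : (f y).toReal ≤ (f u).toReal := EReal.toReal_le_toReal (hy u) (hf.1 y) hutop
  have h5 : t * (f y).toReal ≤ t * (f u).toReal := mul_le_mul_of_nonneg_left h4 ht.1
  have h6 : 1 / (p * l ^ (p - 1)) * dist u x ^ p ≤ 1 / (p * l ^ (p - 1)) * dist (γ t) x ^ p := by
    linarith
  have h7 := le_of_mul_le_mul_left h6 hμ
  rw [dist_comm x, dist_comm x]
  exact (Real.rpow_le_rpow_iff dist_nonneg dist_nonneg hp).1 h7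

theorem IsNearestAlong.dist_le (hG : IsGeodesicSpace G) {x u y : G} (h : IsNearestAlong x u y) :
    dist x u ≤ dist x y := by
  obtain ⟨γ, hγ⟩ := hG u y
  simpa [hγ.2.1] using h γ hγ 1 ⟨zero_le_one, le_rfl⟩

theorem IsNearestAlong.eq_of_self (hG : IsGeodesicSpace G) {u y : G}
    (h : IsNearestAlong y u y) : u = y := by
  have := h.dist_le hG
  rw [dist_self] at this
  exact (dist_le_zero.1 this).symm

/-- Uniform convexity bounds `d(x, γ t)^p` from above, nearness bounds it from below by `d(x,u)^p`.
The difference is divisible by `t`, and `t → 0` turns the factor `1 - t` into `1`. -/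
theorem IsNearestAlong.rpow_add_le {p c : ℝ} (hG : IsPUniformlyConvex p c G) {x u y : G}
    (h : IsNearestAlong x u y) :
    dist x u ^ p + c / 2 * dist u y ^ p ≤ dist x y ^ p := by
  have hp : 0 < p := one_pos.trans hG.1
  obtain ⟨γ, hγ⟩ := hG.2.2.1 u y
  suffices c / 2 * dist u y ^ p ≤ dist x y ^ p - dist x u ^ p by linarith
  refine le_of_forall_one_sub_mul_le fun t ht => ?_
  have ht' := Ioo_subset_Icc_self ht
  have h1 := hG.2.2.2 u y x γ hγ t ht'
  have h2 := Real.rpow_le_rpow dist_nonneg (h γ hγ t ht') hp.le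
  refine le_of_mul_le_mul_left ?_ ht.1
  linarith

/-- In a symmetric perpendicular space, the metric projection does not increase the distance to
points of the convex set, with a uniform gain. -/
theorem rpow_dist_proj_le [CompleteSpace G] {p c : ℝ} (hG : IsPUniformlyConvex p c G)
    (hS : IsSymmPerp G) {C : Set G} (hC : IsClosed C) (hconv : IsGeodConvex C) {y : G}
    (hy : y ∈ C) (x : G) :
    dist (proj C x) y ^ p + c / 2 * dist (proj C x) x ^ p ≤ dist x y ^ p := by
  have hp : 0 < p := one_pos.trans hG.1
  obtain ⟨hu, hmin⟩ := proj_spec hG hC hconv ⟨y, hy⟩ x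
  set u := proj C x
  obtain ⟨γ, hγ⟩ := hG.2.2.1 u x
  obtain ⟨η, hη⟩ := hG.2.2.1 u y
  have h0 : (0 : ℝ) ∈ Icc (0 : ℝ) 1 := ⟨le_rfl, zero_le_one⟩
  have h1 : (1 : ℝ) ∈ Icc (0 : ℝ) 1 := ⟨zero_le_one, le_rfl⟩
  -- `u` stays nearest in `C` when `x` is replaced by any point of the geodesic from `u` to `x`, by
  -- the triangle inequality.
  have hperp : Perp (γ '' Icc (0 : ℝ) 1) (η '' Icc (0 : ℝ) 1) u := by
    rintro _ ⟨s, hs, rfl⟩ _ ⟨t, ht, rfl⟩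
    have h2 := hmin _ (hconv u hu y hy η hη t ht)
    have h3 := hγ.dist_left hs
    have h4 := hγ.dist_right hs
    have h5 := dist_triangle x (γ s) (η t)
    rw [dist_comm x (γ s)] at h5
    rw [dist_comm x u] at h2
    linarith
  -- Symmetry makes `u` the point nearest to `y` on the geodesic to `x`, so the limit argument
  -- applies with `x` and `y` exchanged.
  have hperp' := (hS _ _ ⟨u, x, γ, hγ, rfl⟩ ⟨u, y, η, hη, rfl⟩ u
    ⟨⟨0, h0, hγ.1⟩, ⟨0, h0, hη.1⟩⟩).1 hperp
  have hnear : ∀ t ∈ Icc (0 : ℝ) 1, dist y u ≤ dist y (γ t) := fun t ht =>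
    hperp' y ⟨1, h1, hη.2.1⟩ _ ⟨t, ht, rfl⟩
  suffices c / 2 * dist u x ^ p ≤ dist x y ^ p - dist u y ^ p by linarith
  refine le_of_forall_one_sub_mul_le fun t ht => ?_
  have ht' := Ioo_subset_Icc_self ht
  have h2 := hG.2.2.2 u x y γ hγ t ht'
  have h3 := Real.rpow_le_rpow dist_nonneg (hnear t ht') hp.le
  rw [dist_comm x y, dist_comm u y]
  refine le_of_mul_le_mul_left ?_ ht.1
  linarith

/-! ### Firmness at fixed points -/

/-- Of the six terms, four cancel in pairs and one is zero. -/
theorem psi_of_fixed {p : ℝ} (hp : p ≠ 0) (r : ℝ) {T : G → G} (x : G) {y : G} (hy : T y = y) :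
    psi p r T x y = r / 2 * dist (T x) x ^ p := by
  rw [psi, hy, dist_self, Real.zero_rpow hp]
  ring

theorem firmIneq_iff {p : ℝ} (hp : p ≠ 0) (r : ℝ) {T : G → G} (α ε : ℝ) (x : G) {y : G}
    (hy : T y = y) :
    FirmIneq p r T α ε x y ↔ dist (T x) y ^ p ≤
      (1 + ε) * dist x y ^ p - (1 - α) / α * (r / 2 * dist (T x) x ^ p) := by
  rw [FirmIneq, psi_of_fixed hp r x hy, hy]

/-- Weighted form of uniform convexity along a path of two steps. -/
theorem IsPUniformlyConvex.rpow_dist_le {p c : ℝ} (hG : IsPUniformlyConvex p c G) {k l : ℝ}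
    (hk : 0 < k) (hl : 0 < l) (x z w : G) :
    c / 2 * (k * l / (k + l)) * dist x w ^ p ≤ k * dist z x ^ p + l * dist z w ^ p := by
  obtain ⟨γ, hγ⟩ := hG.2.2.1 x w
  have hkl : 0 < k + l := add_pos hk hl
  have h := hG.2.2.2 x w z γ hγ (l / (k + l))
    ⟨by positivity, (div_le_one hkl).2 (by linarith)⟩
  -- The parameter makes the weights proportional to `k` and `l`; of the left side only
  -- nonnegativity is used.
  have h0 : 0 ≤ dist z (γ (l / (k + l))) ^ p := by positivity
  have h1 := mul_le_mul_of_nonneg_left (h0.trans h) hkl.le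
  have e1 : 1 - l / (k + l) = k / (k + l) := by field_simp; ring
  rw [mul_zero, e1] at h1
  have e2 : (k + l) * (k / (k + l) * dist z x ^ p + l / (k + l) * dist z w ^ p
      - c / 2 * (l / (k + l) * (k / (k + l))) * dist x w ^ p)
      = k * dist z x ^ p + l * dist z w ^ p - c / 2 * (k * l / (k + l)) * dist x w ^ p := by
    field_simp
  linarith

/-- With `k = (1 - a) / a` and `l = (1 - b) / b`, the gains of the two steps are bounded below
through `rpow_dist_le` by a multiple of `d(x, S(T x))^p`; `hα` says that `α` encodes this multiple.
`S` must be firm on all of `G` because `T` may leave `D`. -/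
theorem AlmostFirmAt.comp {p c : ℝ} (hG : IsPUniformlyConvex p c G) {S T : G → G} {D : Set G}
    {y : G} {a b α ε δ : ℝ} (hSy : S y = y) (hTy : T y = y) (hT : AlmostFirmAt p c T D y a ε)
    (hS : AlmostFirmAt p c S univ y b δ) (h0 : 0 < α) (h1 : α < 1)
    (hα : (1 - α) / α = c / 2 * (((1 - a) / a) * ((1 - b) / b) / ((1 - a) / a + (1 - b) / b))) :
    AlmostFirmAt p c (S ∘ T) D y α (ε + δ + ε * δ) := by
  have hp : p ≠ 0 := (one_pos.trans hG.1).ne'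
  have hc := hG.2.1
  obtain ⟨ha0, ha1, hε, hyD, hT⟩ := hT
  obtain ⟨hb0, hb1, hδ, -, hS⟩ := hS
  refine ⟨h0, h1, by positivity, hyD, fun x hx => ?_⟩
  have hTx := (firmIneq_iff hp c a ε x hTy).1 (hT x hx)
  have hSx := (firmIneq_iff hp c b δ (T x) hSy).1 (hS (T x) (mem_univ _))
  rw [firmIneq_iff hp c α _ x (by simp [hTy, hSy]), hα]
  have hk : 0 < (1 - a) / a := div_pos (by linarith) ha0
  have hl : 0 < (1 - b) / b := div_pos (by linarith) hb0
  have h2 := hG.rpow_dist_le hk hl x (T x) (S (T x))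
  rw [dist_comm x, dist_comm (T x) (S (T x))] at h2
  simp only [Function.comp_apply]
  set k := (1 - a) / a
  set l := (1 - b) / b
  have h3 := mul_le_mul_of_nonneg_left h2 (by positivity : 0 ≤ c / 2)
  -- The factor `1 + δ` also enlarges the gain of `T`; the surplus, `h5`, is discarded.
  have h4 := mul_le_mul_of_nonneg_left hTx (by positivity : 0 ≤ 1 + δ)
  have h5 : 0 ≤ δ * (k * (c / 2 * dist (T x) x ^ p)) := by positivity
  nlinarith

theorem almostFirmAt_of_rpow_le {p c : ℝ} (hp : p ≠ 0) {S : G → G} {y : G} {α ε : ℝ}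
    (hSy : S y = y) (h0 : 0 < α) (h1 : α < 1) (hε : 0 ≤ ε)
    (h : ∀ x, dist (S x) y ^ p + (1 - α) / α * (c / 2 * dist (S x) x ^ p)
      ≤ (1 + ε) * dist x y ^ p) :
    AlmostFirmAt p c S univ y α ε :=
  ⟨h0, h1, hε, mem_univ _, fun x _ => (firmIneq_iff hp c α ε x hSy).2 (by linarith [h x])⟩

/-! ### Firmness constants of proximal maps, projectors, compositions and relaxations. -/

theorem alphaC_pos {c : ℝ} (hc : 1 < c) : 0 < alphaC c := by
  have : 0 < c * (c - 1) := by nlinarith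
  rw [alphaC]; positivity

theorem alphaC_lt_one {c : ℝ} (hc : 1 < c) : alphaC c < 1 := by
  have : 0 < c * (c - 1) := by nlinarith
  rw [alphaC, div_lt_one (by linarith)]; linarith

theorem one_sub_alphaC_div {c : ℝ} (hc : 1 < c) :
    (1 - alphaC c) / alphaC c = 2 / (c * (c - 1)) := by
  have h : 0 < c * (c - 1) := by nlinarith
  rw [alphaC, one_sub_div (by linarith : c * (c - 1) + 2 ≠ 0),
    div_div_div_cancel_right₀ (by linarith)]
  ring

theorem epsC_nonneg {c : ℝ} (hc : 1 < c) (hc2 : c ≤ 2) : 0 ≤ epsC c :=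
  div_nonneg (by linarith) (by linarith)

theorem one_add_epsC {c : ℝ} (hc : 1 < c) : 1 + epsC c = 1 / (c - 1) := by
  have : c - 1 ≠ 0 := by linarith
  rw [epsC]; field_simp; ring

/-- Since `c ≤ 2`, the coefficient `c / 2` in `rpow_add_le` may be lowered to `c - 1`; division by
`c - 1` gives both constants. -/
theorem almostFirmAt_of_isNearestAlong {p c : ℝ} (hG : IsPUniformlyConvex p c G) (hc1 : 1 < c)
    (hc2 : c ≤ 2) {S : G → G} {y : G} (hS : ∀ x, IsNearestAlong x (S x) y) :
    AlmostFirmAt p c S univ y (alphaC c) (epsC c) := by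
  refine almostFirmAt_of_rpow_le (one_pos.trans hG.1).ne' ((hS y).eq_of_self hG.2.2.1)
    (alphaC_pos hc1) (alphaC_lt_one hc1) (epsC_nonneg hc1 hc2) fun x => ?_
  have h := (hS x).rpow_add_le hG
  rw [dist_comm x (S x)] at h
  have hc : 0 < c - 1 := by linarith
  have h1 : (c - 1) * dist (S x) y ^ p ≤ c / 2 * dist (S x) y ^ p :=
    mul_le_mul_of_nonneg_right (by linarith) (by positivity)
  rw [one_sub_alphaC_div hc1, one_add_epsC hc1,
    show dist (S x) y ^ p + 2 / (c * (c - 1)) * (c / 2 * dist (S x) x ^ p)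
      = 1 / (c - 1) * ((c - 1) * dist (S x) y ^ p + dist (S x) x ^ p) by field_simp]
  gcongr
  linarith

/-- Here `d(Sx,y)^p` already has coefficient `1`, hence no violation and `(1 - α) / α = 1`. -/
theorem almostFirmAt_proj [CompleteSpace G] {p c : ℝ} (hG : IsPUniformlyConvex p c G)
    (hS : IsSymmPerp G) {C : Set G} (hC : IsClosed C) (hconv : IsGeodConvex C) {y : G}
    (hy : y ∈ C) : AlmostFirmAt p c (proj C) univ y (1 / 2) 0 := by
  refine almostFirmAt_of_rpow_le (one_pos.trans hG.1).ne'
    ((isNearestAlong_proj hG hC hconv hy y).eq_of_self hG.2.2.1) (by norm_num) (by norm_num)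
    le_rfl fun x => ?_
  have h := rpow_dist_proj_le hG hS hC hconv hy x
  norm_num
  linarith

/-- `alphaComp` solves the equation required by `AlmostFirmAt.comp`. -/
theorem div_of_comp_const {a b : ℝ} (c : ℝ) (ha0 : 0 < a) (ha1 : a < 1) (hb0 : 0 < b)
    (hb1 : b < 1) (hc : 0 < c) :
    0 < alphaComp c a b ∧ alphaComp c a b < 1 ∧
    (1 - alphaComp c a b) / alphaComp c a b
      = c / 2 * (((1 - a) / a) * ((1 - b) / b) / ((1 - a) / a + (1 - b) / b)) := by
  have h1 : 0 < 1 - a := by linarith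
  have h2 : 0 < 1 - b := by linarith
  have h3 : 0 < a + b - 2 * a * b := by nlinarith [mul_pos ha0 h2, mul_pos hb0 h1]
  have h4 : 0 < c / 2 * (1 - a - b + a * b) := by
    have : 1 - a - b + a * b = (1 - a) * (1 - b) := by ring
    rw [this]; positivity
  have h5 : 0 < c / 2 * (1 - a - b + a * b) + a + b - 2 * a * b := by linarith
  refine ⟨div_pos h3 h5, (div_lt_one h5).2 (by linarith), ?_⟩
  have h6 : (1 - a) / a + (1 - b) / b = (a + b - 2 * a * b) / (a * b) := by field_simp; ring
  rw [alphaComp, one_sub_div h5.ne', div_div_div_cancel_right₀ h5.ne', h6, div_mul_div_comm (1 - a) a,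
    div_div_div_cancel_right₀ (mul_pos ha0 hb0).ne']
  ring

theorem almostFirmAt_comp_prox [CompleteSpace G] {p c l : ℝ} (hG : IsPUniformlyConvex p c G)
    (hc1 : 1 < c) (hc2 : c ≤ 2) (hl : 0 < l) {f : G → EReal} (hf : IsProperConvexLsc f) {y : G}
    (hy : y ∈ argmin f) {T : G → G} (hTy : T y = y) {D : Set G} {a ε : ℝ}
    (hT : AlmostFirmAt p c T D y a ε) :
    AlmostFirmAt p c (prox p l f ∘ T) D y (alphaComp c a (alphaC c))
      (ε + epsC c + ε * epsC c) := by
  obtain ⟨h0, h1, h2⟩ := div_of_comp_const c hT.1 hT.2.1 (alphaC_pos hc1) (alphaC_lt_one hc1)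
    (one_pos.trans hc1)
  have hS := isNearestAlong_prox hG hl hf hy
  exact hT.comp hG ((hS y).eq_of_self hG.2.2.1) hTy
    (almostFirmAt_of_isNearestAlong hG hc1 hc2 hS) h0 h1 h2

theorem dist_km (hG : IsGeodesicSpace G) {β : ℝ} (hβ : β ∈ Ioc (0 : ℝ) 1) (S : G → G) (x : G) :
    dist (km β S x) x = β * dist (S x) x := by
  obtain ⟨γ, hγ, h⟩ := geoComb_spec hG β x (S x)
  rw [km, h, hγ.dist_left ⟨hβ.1.le, hβ.2⟩, dist_comm]

theorem km_of_fixed (hG : IsGeodesicSpace G) {β : ℝ} (hβ : β ∈ Ioc (0 : ℝ) 1) {S : G → G} {y : G}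
    (hy : S y = y) : km β S y = y := by
  have := dist_km hG hβ S y
  rwa [hy, dist_self, mul_zero, dist_eq_zero] at this

theorem div_of_km_const {a β q : ℝ} (ha0 : 0 < a) (ha1 : a < 1) (hβ : β ∈ Ioc (0 : ℝ) 1)
    (hq : 0 < q) :
    0 < a * q / (a * q - a * β + 1) ∧ a * q / (a * q - a * β + 1) < 1 ∧
    (1 - a * q / (a * q - a * β + 1)) / (a * q / (a * q - a * β + 1))
      = ((1 - a) / a + 1 - β) / q := by
  have h1 : 0 < a * q := mul_pos ha0 hq
  have h2 : a * β < 1 := (mul_le_of_le_one_right ha0.le hβ.2).trans_lt ha1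
  have h3 : 0 < a * q - a * β + 1 := by linarith
  refine ⟨by positivity, (div_lt_one h3).2 (by linarith), ?_⟩
  rw [one_sub_div h3.ne', div_div_div_cancel_right₀ h3.ne', div_eq_div_iff h1.ne' hq.ne']
  field_simp
  ring

/-- Inserting firmness of `S` into uniform convexity at parameter `β` gives the gain `β ((1 - a) / a
+ 1 - β)` times `(c / 2) d(Sx,x)^p`. As the relaxed step has length `β d(Sx,x)`, division by `β ^ p`
leaves the denominator `β ^ (p - 1)`. -/
theorem AlmostFirmAt.km {p c : ℝ} (hG : IsPUniformlyConvex p c G) {S : G → G} {D : Set G}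
    {y : G} {a ε β : ℝ} (hβ : β ∈ Ioc (0 : ℝ) 1) (hSy : S y = y)
    (hS : AlmostFirmAt p c S D y a ε) :
    AlmostFirmAt p c (km β S) D y (a * β ^ (p - 1) / (a * β ^ (p - 1) - a * β + 1)) (β * ε) := by
  have hp : p ≠ 0 := (one_pos.trans hG.1).ne'
  obtain ⟨ha0, ha1, hε, hyD, hS⟩ := hS
  have hq : 0 < β ^ (p - 1) := Real.rpow_pos_of_pos hβ.1 _
  obtain ⟨h0, h1, h2⟩ := div_of_km_const ha0 ha1 hβ hq
  refine ⟨h0, h1, mul_nonneg hβ.1.le hε, hyD, fun x hx => ?_⟩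
  rw [firmIneq_iff hp c _ _ x (km_of_fixed hG.2.2.1 hβ hSy), h2, dist_km hG.2.2.1 hβ,
    Real.mul_rpow hβ.1.le dist_nonneg]
  have h3 := (firmIneq_iff hp c a ε x hSy).1 (hS x hx)
  obtain ⟨γ, hγ, h⟩ := geoComb_spec hG.2.2.1 β x (S x)
  have h4 := hG.2.2.2 x (S x) y γ hγ β ⟨hβ.1.le, hβ.2⟩
  rw [← h, dist_comm y, dist_comm y, dist_comm y, dist_comm x (S x)] at h4
  have h5 : β ^ p = β ^ (p - 1) * β := by
    rw [← Real.rpow_add_one hβ.1.ne']; ring_nf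
  have h6 : ((1 - a) / a + 1 - β) / β ^ (p - 1) * (c / 2 * (β ^ p * dist (S x) x ^ p))
      = ((1 - a) / a + 1 - β) * β * (c / 2 * dist (S x) x ^ p) := by
    rw [h5]; field_simp
  rw [h6, ProxFirm.km]
  have h7 := mul_le_mul_of_nonneg_left h3 hβ.1.le
  linarith

/-! ### Local comparison in CAT(κ) spaces -/

/-- The point dividing a short geodesic of the unit sphere in a given proportion. -/
theorem exists_sphere_point {u y : Sph} {θ s : ℝ}
    (hθ : InnerProductGeometry.angle (u : EuclideanSpace ℝ (Fin 3)) y = θ) (h0 : 0 < θ)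
    (hπ : θ < Real.pi) (hs : s ∈ Icc (0 : ℝ) 1) :
    ∃ w : Sph, InnerProductGeometry.angle (u : EuclideanSpace ℝ (Fin 3)) w = s * θ ∧
      InnerProductGeometry.angle (w : EuclideanSpace ℝ (Fin 3)) y = (1 - s) * θ ∧
      ∀ x : Sph, Real.cos (InnerProductGeometry.angle (w : EuclideanSpace ℝ (Fin 3)) x)
          * Real.sin θ =
        Real.sin ((1 - s) * θ) *
            Real.cos (InnerProductGeometry.angle (u : EuclideanSpace ℝ (Fin 3)) x) +
          Real.sin (s * θ) *
            Real.cos (InnerProductGeometry.angle (y : EuclideanSpace ℝ (Fin 3)) x) := by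
  have hn : ∀ z : Sph, ‖(z : EuclideanSpace ℝ (Fin 3))‖ = 1 := fun z =>
    mem_sphere_zero_iff_norm.1 z.2
  have hsin : 0 < Real.sin θ := Real.sin_pos_of_pos_of_lt_pi h0 hπ
  have hcos : ∀ z z' : Sph, inner ℝ (z : EuclideanSpace ℝ (Fin 3)) (z' : EuclideanSpace ℝ (Fin 3))
      = Real.cos (InnerProductGeometry.angle (z : EuclideanSpace ℝ (Fin 3)) z') := fun z z' =>
    InnerProductGeometry.inner_eq_cos_angle_of_norm_eq_one (hn z) (hn z')
  have huy : inner ℝ (u : EuclideanSpace ℝ (Fin 3)) (y : EuclideanSpace ℝ (Fin 3)) = Real.cos θ := by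
    rw [hcos, hθ]
  have hself : ∀ z : Sph,
      inner ℝ (z : EuclideanSpace ℝ (Fin 3)) (z : EuclideanSpace ℝ (Fin 3)) = 1 := fun z => by
    rw [real_inner_self_eq_norm_sq, hn, one_pow]
  -- Coefficients of spherical linear interpolation; the cosine identity is then linearity of the
  -- inner product.
  set A := Real.sin ((1 - s) * θ) / Real.sin θ with hA
  set B := Real.sin (s * θ) / Real.sin θ with hB
  have hsum : Real.sin θ = Real.sin ((1 - s) * θ) * Real.cos (s * θ)
      + Real.cos ((1 - s) * θ) * Real.sin (s * θ) := by
    rw [← Real.sin_add]; ring_nf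
  have hsub1 : Real.sin ((1 - s) * θ) = Real.sin θ * Real.cos (s * θ)
      - Real.cos θ * Real.sin (s * θ) := by
    rw [← Real.sin_sub]; ring_nf
  have hsub2 : Real.sin (s * θ) = Real.sin θ * Real.cos ((1 - s) * θ)
      - Real.cos θ * Real.sin ((1 - s) * θ) := by
    rw [← Real.sin_sub]; ring_nf
  have hAB1 : A + B * Real.cos θ = Real.cos (s * θ) := by
    rw [hA, hB]; field_simp; linarith
  have hAB2 : A * Real.cos θ + B = Real.cos ((1 - s) * θ) := by
    rw [hA, hB]; field_simp; linarith
  set w : EuclideanSpace ℝ (Fin 3) := A • (u : EuclideanSpace ℝ (Fin 3)) + B • (y : EuclideanSpace ℝ (Fin 3))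
    with hw
  have hwi : ∀ x : EuclideanSpace ℝ (Fin 3), inner ℝ w x = A * inner ℝ (u : EuclideanSpace ℝ (Fin 3)) x
      + B * inner ℝ (y : EuclideanSpace ℝ (Fin 3)) x := fun x => by
    rw [hw, inner_add_left, real_inner_smul_left, real_inner_smul_left]
  have hwu : inner ℝ w (u : EuclideanSpace ℝ (Fin 3)) = Real.cos (s * θ) := by
    rw [hwi, hself, real_inner_comm, huy, mul_one, hAB1]
  have hwy : inner ℝ w (y : EuclideanSpace ℝ (Fin 3)) = Real.cos ((1 - s) * θ) := by
    rw [hwi, hself, huy, mul_one, hAB2]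
  have hww : ‖w‖ = 1 := by
    have : ‖w‖ ^ 2 = 1 := by
      rw [← real_inner_self_eq_norm_sq, hwi, real_inner_comm, hwu, real_inner_comm, hwy, hA, hB]
      field_simp
      linarith
    exact (pow_eq_one_iff_of_nonneg (norm_nonneg w) two_ne_zero).1 this
  refine ⟨⟨w, mem_sphere_zero_iff_norm.2 hww⟩, ?_, ?_, fun x => ?_⟩
  · rw [InnerProductGeometry.angle, real_inner_comm, hwu, hn, hww, mul_one, div_one]
    exact Real.arccos_cos (mul_nonneg hs.1 h0.le) (by nlinarith [hs.2])
  · rw [InnerProductGeometry.angle, hwy, hww, hn, mul_one, div_one]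
    exact Real.arccos_cos (mul_nonneg (sub_nonneg.2 hs.2) h0.le) (by nlinarith [hs.1])
  · rw [← hcos, ← hcos, ← hcos, hwi, hA, hB]
    field_simp

/-- Taylor expansion of the spherical identity, divided by `θ`: the leading terms form the Euclidean
identity, and the remainder is absorbed into `ρ` times the squared sides. -/
theorem sq_le_of_cos_mul_sin_eq {θ a b m s ρ : ℝ} (hθ0 : 0 < θ) (hθ : θ ≤ ρ)
    (hb : b ≤ ρ) (hρ : ρ ≤ 1 / 4) (hm0 : 0 ≤ m) (hm : m ≤ θ + b)
    (hs : s ∈ Icc (0 : ℝ) 1)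
    (h : Real.cos m * Real.sin θ
      = Real.sin ((1 - s) * θ) * Real.cos b + Real.sin (s * θ) * Real.cos a) :
    m ^ 2 ≤ (1 - s) * b ^ 2 + s * a ^ 2 - s * (1 - s) * θ ^ 2
      + 2 * ρ * (a ^ 2 + b ^ 2 + θ ^ 2) := by
  obtain ⟨hs0, hs1⟩ := hs
  have hs2 : 0 ≤ 1 - s := by linarith
  have hρ0 : 0 < ρ := hθ0.trans_le hθ
  have hsθ0 : 0 ≤ s * θ := by positivity
  have hsθ : s * θ ≤ θ := mul_le_of_le_one_left hθ0.le hs1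
  have htθ0 : 0 ≤ (1 - s) * θ := by positivity
  have htθ : (1 - s) * θ ≤ θ := mul_le_of_le_one_left hθ0.le (by linarith)
  have quart : ∀ x : ℝ, 0 ≤ x → x ≤ θ → |Real.sin x - (x - x ^ 3 / 6)| ≤ θ ^ 4 / 100 := by
    intro x hx0 hx
    refine (Real.sin_bound (by rw [abs_of_nonneg hx0]; linarith)).trans ?_
    rw [abs_of_nonneg hx0]
    have h5 : x ^ 5 ≤ θ ^ 5 := pow_le_pow_left₀ hx0 hx 5
    have h6 : θ ^ 5 ≤ θ ^ 4 := pow_le_pow_of_le_one hθ0.le (by linarith) (by norm_num)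
    linarith
  have e1 := (abs_le.1 (quart θ hθ0.le le_rfl)).2
  have e2 := (abs_le.1 (quart _ hsθ0 hsθ)).1
  have e3 := (abs_le.1 (quart _ htθ0 htθ)).1
  have ca := Real.one_sub_sq_div_two_le_cos (x := a)
  have cb := Real.one_sub_sq_div_two_le_cos (x := b)
  have cm := Real.one_sub_sq_div_two_le_cos (x := m)
  have cm' := (abs_le.1 (Real.cos_bound (x := m) (by rw [abs_of_nonneg hm0]; linarith))).2
  rw [abs_of_nonneg hm0] at cm'
  have s1 : Real.sin ((1 - s) * θ) * (1 - Real.cos b) ≤ (1 - s) * θ * (b ^ 2 / 2) :=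
    mul_le_mul (Real.sin_le htθ0) (by linarith) (by linarith [Real.cos_le_one b]) htθ0
  have s2 : Real.sin (s * θ) * (1 - Real.cos a) ≤ s * θ * (a ^ 2 / 2) :=
    mul_le_mul (Real.sin_le hsθ0) (by linarith) (by linarith [Real.cos_le_one a]) hsθ0
  have s3 := mul_le_mul_of_nonneg_right (Real.sin_gt_sub_cube hθ0).le
    (by linarith [Real.cos_le_one m] : 0 ≤ 1 - Real.cos m)
  have key : (1 - θ ^ 2 / 6) * (1 - Real.cos m)
      ≤ ((1 - s) * b ^ 2 + s * a ^ 2 - s * (1 - s) * θ ^ 2) / 2 + θ ^ 3 / 6 := by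
    -- The term `s (1 - s) θ ^ 2` comes from the cubic terms of the sines, as `1 - s ^ 3 - (1 - s) ^
    -- 3 = 3 s (1 - s)`.
    refine le_of_mul_le_mul_left ?_ hθ0
    have h4 : 0 ≤ θ ^ 4 := by positivity
    linarith
  have hm2 : m ^ 2 ≤ 2 * (θ ^ 2 + b ^ 2) := by
    have := pow_le_pow_left₀ hm0 hm 2
    linarith [sq_nonneg (θ - b)]
  have hmρ : m ^ 2 ≤ ρ := by
    have h1 : m ^ 2 ≤ (2 * ρ) ^ 2 := pow_le_pow_left₀ hm0 (by linarith) 2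
    have h2 : ρ * ρ ≤ ρ * (1 / 4) := mul_le_mul_of_nonneg_left hρ hρ0.le
    linarith
  have hθρ : θ ^ 2 ≤ ρ := by
    have h1 : θ ^ 2 ≤ ρ ^ 2 := pow_le_pow_left₀ hθ0.le hθ 2
    have h2 : ρ * ρ ≤ ρ * (1 / 4) := mul_le_mul_of_nonneg_left hρ hρ0.le
    linarith
  have t1 : θ ^ 3 ≤ ρ * θ ^ 2 := by
    rw [pow_succ' θ 2]
    exact mul_le_mul_of_nonneg_right hθ (sq_nonneg θ)
  have t2 : θ ^ 2 * (1 - Real.cos m) ≤ ρ * (m ^ 2 / 2) :=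
    mul_le_mul hθρ (by linarith) (by linarith [Real.cos_le_one m]) hρ0.le
  have t3 : m ^ 4 ≤ ρ * m ^ 2 := by
    rw [show m ^ 4 = m ^ 2 * m ^ 2 by ring]
    exact mul_le_mul_of_nonneg_right hmρ (sq_nonneg m)
  have t4 : ρ * m ^ 2 ≤ ρ * (2 * (θ ^ 2 + b ^ 2)) := mul_le_mul_of_nonneg_left hm2 hρ0.le
  have t5 : 0 ≤ ρ * a ^ 2 := by positivity
  have t6 : 0 ≤ ρ * b ^ 2 := by positivity
  have t7 : 0 ≤ ρ * θ ^ 2 := by positivity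
  linarith

/-- Small triangles of a CAT(κ) space satisfy the CAT(0) inequality up to an error that is
small in proportion to the squares of the side lengths. -/
theorem IsCAT.exists_sq_dist_le {κ : ℝ} (hκ : IsCAT κ G) {δ : ℝ} (hδ : 0 < δ) :
    ∃ ρ > 0, ∀ (x u y : G) (γ : ℝ → G), IsGeodesic γ u y → dist x u ≤ ρ → dist x y ≤ ρ →
      dist u y ≤ ρ → ∀ s ∈ Icc (0 : ℝ) 1,
        dist x (γ s) ^ 2 ≤ (1 - s) * dist x u ^ 2 + s * dist x y ^ 2
          - s * (1 - s) * dist u y ^ 2 + δ * (dist x u ^ 2 + dist x y ^ 2 + dist u y ^ 2) := by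
  obtain ⟨hκ0, hgeo, hcomp⟩ := hκ
  have hq : 0 < Real.sqrt κ := Real.sqrt_pos.2 hκ0
  set q := Real.sqrt κ
  set r := min (1 / 4) (δ / 2) with hr
  have hr0 : 0 < r := by positivity
  have hr4 : r ≤ 1 / 4 := min_le_left _ _
  have hrδ : 2 * r ≤ δ := by linarith [min_le_right (1 / 4) (δ / 2)]
  refine ⟨r / q, by positivity, fun x u y γ hγ hxu hxy huy s hs => ?_⟩
  -- A degenerate side has `sin θ = 0`, where the spherical formula says nothing.
  rcases eq_or_ne u y with rfl | hne
  · have h1 := hγ.dist_left hs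
    rw [dist_self, mul_zero, dist_eq_zero] at h1
    rw [h1, dist_self]
    have : 0 ≤ δ * (dist x u ^ 2 + dist x u ^ 2 + 0 ^ 2) := by positivity
    linarith
  have hpi := Real.pi_gt_three
  obtain ⟨η, hη⟩ := hgeo u x (by
    rw [dist_comm]
    refine hxu.trans_lt ?_
    gcongr
    linarith)
  obtain ⟨u', y', x', huy', hyx', hux', hle⟩ := hcomp u y x γ η hγ hη (by
    rw [dist_comm y x]
    have : 3 * (r / q) < 2 * Real.pi / q := by
      rw [← mul_div_assoc]; exact div_lt_div_of_pos_right (by linarith) hq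
    linarith)
  have hang : ∀ (z z' : Sph) (d : ℝ), modelDist κ z z' = d →
      InnerProductGeometry.angle (z : EuclideanSpace ℝ (Fin 3)) z' = q * d := by
    rintro z z' d rfl
    rw [modelDist]; exact (mul_div_cancel₀ _ hq.ne').symm
  have hmod : ∀ (z z' : Sph) (d : ℝ),
      InnerProductGeometry.angle (z : EuclideanSpace ℝ (Fin 3)) z' = q * d →
      modelDist κ z z' = d := by
    intro z z' d h
    rw [modelDist, h]; exact mul_div_cancel_left₀ _ hq.ne'
  have hpos : 0 < q * dist u y := mul_pos hq (dist_pos.2 hne)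
  have hsmall : ∀ d, d ≤ r / q → q * d ≤ r := fun d hd => by
    rw [mul_comm]; exact (le_div_iff₀ hq).1 hd
  obtain ⟨w, hw1, hw2, hw3⟩ := exists_sphere_point (hang _ _ _ huy') hpos
    (by linarith [hsmall _ huy]) hs
  have hx'0 : (x' : EuclideanSpace ℝ (Fin 3)) ≠ 0 := fun h => by
    have := mem_sphere_zero_iff_norm.1 x'.2
    rw [h, norm_zero] at this
    exact zero_ne_one this
  -- The second comparison point is the vertex `x` itself, the endpoint of the side from `u` to `x`.
  have hcmp := hle s hs 1 ⟨zero_le_one, le_rfl⟩ w x' (hmod _ _ _ (by rw [hw1]; ring))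
    (hmod _ _ _ (by rw [hw2]; ring)) (by rw [hux', one_mul])
    (hmod _ _ _ (by rw [InnerProductGeometry.angle_self hx'0]; ring))
  rw [hη.2.1] at hcmp
  have h3 := hw3 x'
  rw [hang _ _ _ hux', hang _ _ _ hyx'] at h3
  have htri := InnerProductGeometry.angle_le_angle_add_angle (w : EuclideanSpace ℝ (Fin 3)) u' x'
  rw [InnerProductGeometry.angle_comm, InnerProductGeometry.angle_comm (w : EuclideanSpace ℝ (Fin 3)) u',
    hw1, hang _ _ _ hux', InnerProductGeometry.angle_comm] at htri
  rw [dist_comm u x, dist_comm y x] at *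
  have hm2 := sq_le_of_cos_mul_sin_eq hpos (hsmall _ huy)
    (hsmall _ hxu) hr4 (InnerProductGeometry.angle_nonneg _ _)
    (htri.trans (add_le_add_left (mul_le_of_le_one_left hpos.le hs.2) _)) hs h3
  have hd : (q * dist x (γ s)) ^ 2
      ≤ InnerProductGeometry.angle (w : EuclideanSpace ℝ (Fin 3)) x' ^ 2 := by
    rw [modelDist, le_div_iff₀ hq, mul_comm, dist_comm] at hcmp
    gcongr
  refine le_of_mul_le_mul_left ?_ (by positivity : 0 < q ^ 2)
  have hS : 0 ≤ q ^ 2 * (dist x u ^ 2 + dist x y ^ 2 + dist u y ^ 2) := by positivity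
  have h5 := mul_le_mul_of_nonneg_right hrδ hS
  linarith

/-! ### Asymptotic firmness -/

theorem firmIneq_two_iff (r : ℝ) {T : G → G} (α ε : ℝ) (x : G) {y : G} (hy : T y = y) :
    FirmIneq 2 r T α ε x y ↔
      dist (T x) y ^ 2 ≤ (1 + ε) * dist x y ^ 2 - (1 - α) / α * (r / 2 * dist (T x) x ^ 2) := by
  rw [firmIneq_iff two_ne_zero r α ε x hy]
  simp only [Real.rpow_two]

/-- The counterpart of `rpow_add_le` for `c = 2`. The comparison error carries no factor `t`, so `t`
cannot tend to `0`: it is fixed in terms of `ε`, and the error `t ^ 2` leaves `t` after division. -/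
theorem IsCAT.exists_sq_dist_nearest_le {κ : ℝ} (hκ : IsCAT κ G) (hG : IsGeodesicSpace G)
    {ε : ℝ} (hε : 0 < ε) :
    ∃ ρ > 0, ∀ x u y : G, IsNearestAlong x u y → dist x y ≤ ρ →
      dist u y ^ 2 ≤ (1 + ε) * dist x y ^ 2 - dist u x ^ 2 := by
  set t := min 1 (ε / 10) with ht
  have ht0 : 0 < t := by positivity
  have ht1 : t ≤ 1 := min_le_left _ _
  have htε : 10 * t ≤ ε := by linarith [min_le_right 1 (ε / 10)]
  obtain ⟨ρ, hρ, h⟩ := hκ.exists_sq_dist_le (δ := t ^ 2) (by positivity)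
  refine ⟨ρ / 2, by positivity, fun x u y hu hxy => ?_⟩
  obtain ⟨γ, hγ⟩ := hG u y
  have hb := hu.dist_le hG
  have hθ : dist u y ≤ 2 * dist x y := by linarith [dist_triangle_left u y x]
  have h1 := h x u y γ hγ (by linarith) (by linarith) (by linarith) t ⟨ht0.le, ht1⟩
  have h2 := pow_le_pow_left₀ dist_nonneg (hu γ hγ t ⟨ht0.le, ht1⟩) 2
  have hb2 := pow_le_pow_left₀ dist_nonneg hb 2
  have hθ2 := pow_le_pow_left₀ dist_nonneg hθ 2
  have h3 : t * (dist x u ^ 2 + (1 - t) * dist u y ^ 2)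
      ≤ t * (dist x y ^ 2 + t * (dist x u ^ 2 + dist x y ^ 2 + dist u y ^ 2)) := by linarith
  have h4 := le_of_mul_le_mul_left h3 ht0
  -- From `d(x,u) ≤ d(x,y)` and `d(u,y) ≤ 2 d(x,y)`: `1 + 1 + 2 · 4 = 10`, whence the choice `10 t ≤
  -- ε`.
  have h5 : t * (dist x u ^ 2 + dist x y ^ 2 + 2 * dist u y ^ 2) ≤ t * (10 * dist x y ^ 2) :=
    mul_le_mul_of_nonneg_left (by linarith) ht0.le
  have h6 := mul_le_mul_of_nonneg_right htε (sq_nonneg (dist x y))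
  rw [dist_comm u x]
  linarith

theorem asympFirmAt_of_isNearestAlong {κ : ℝ} (hκ : IsCAT κ G) (hG : IsGeodesicSpace G) {r : ℝ}
    (hr : r ≤ 2) {S : G → G} {y : G} (hS : ∀ x, IsNearestAlong x (S x) y) :
    AsympFirmAt 2 r S y (1 / 2) := by
  refine ⟨by norm_num, by norm_num, fun ε hε => ?_⟩
  obtain ⟨ρ, hρ, h⟩ := hκ.exists_sq_dist_nearest_le hG hε
  refine ⟨_, Metric.closedBall_mem_nhds y hρ, fun x hx => ?_⟩
  rw [firmIneq_two_iff r _ _ x ((hS y).eq_of_self hG)]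
  have h1 := h x (S x) y (hS x) hx
  have h2 : r / 2 * dist (S x) x ^ 2 ≤ 1 * dist (S x) x ^ 2 := by gcongr; linarith
  norm_num
  linarith

/-- Weighted Cauchy–Schwarz with weights `k = (1 - a) / a` and `1`, for which `k / (k + 1) = 1 - a`.
-/
theorem harmonic_mul_sq_le {a u v : ℝ} (h0 : 0 < a) :
    (1 - a) * (u + v) ^ 2 ≤ (1 - a) / a * u ^ 2 + v ^ 2 := by
  have h : (1 - a) / a * u ^ 2 + v ^ 2 - (1 - a) * (u + v) ^ 2
      = ((1 - a) * u - a * v) ^ 2 / a := by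
    field_simp; ring
  have : 0 ≤ ((1 - a) * u - a * v) ^ 2 / a := by positivity
  linarith

/-- For squares, the triangle inequality and `harmonic_mul_sq_le` replace uniform convexity, so no
factor `c / 2` is lost. -/
theorem AsympFirmAt.comp {r : ℝ} (hr : 0 < r) {S T : G → G} {y : G} {a : ℝ} (hSy : S y = y)
    (hTy : T y = y) (hT : AsympFirmAt 2 r T y a) (hS : AsympFirmAt 2 r S y (1 / 2)) :
    AsympFirmAt 2 r (S ∘ T) y (1 / (2 - a)) := by
  obtain ⟨ha0, ha1, hT⟩ := hT
  have h2a : 0 < 2 - a := by linarith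
  refine ⟨by positivity, (div_lt_one h2a).2 (by linarith), fun ε hε => ?_⟩
  -- Chosen so that `(1 + e) ^ 2 ≤ 1 + 3 e ≤ 1 + ε`.
  set e := min 1 (ε / 3) with he
  have he0 : 0 < e := by positivity
  have he1 : e ≤ 1 := min_le_left _ _
  have heε : 3 * e ≤ ε := by linarith [min_le_right 1 (ε / 3)]
  obtain ⟨DT, hDT, hT⟩ := hT e he0
  obtain ⟨DS, hDS, hS⟩ := hS.2.2 e he0
  obtain ⟨ρ, hρ, hball⟩ := Metric.mem_nhds_iff.1 hDS
  refine ⟨DT ∩ Metric.ball y (ρ / 2),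
    inter_mem hDT (Metric.ball_mem_nhds y (by positivity)), fun x hx => ?_⟩
  have hTx := (firmIneq_two_iff r a e x hTy).1 (hT x hx.1)
  have hxρ : dist x y < ρ / 2 := hx.2
  have hk : 0 < (1 - a) / a := div_pos (by linarith) ha0
  have h0 : 0 ≤ (1 - a) / a * (r / 2 * dist (T x) x ^ 2) := by positivity
  -- This keeps `T x` in the ball of radius `ρ`, where `S` is controlled.
  have hTxy : dist (T x) y ≤ 2 * dist x y := by
    refine le_of_sq_le_sq ?_ (by positivity)
    have := mul_le_mul_of_nonneg_right he1 (sq_nonneg (dist x y))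
    linarith [sq_nonneg (dist x y)]
  have hSx := (firmIneq_two_iff r (1 / 2) e (T x) hSy).1
    (hS (T x) (hball (show dist (T x) y < ρ by linarith)))
  rw [firmIneq_two_iff r _ _ x (by simp [hTy, hSy])]
  have hα : (1 - 1 / (2 - a)) / (1 / (2 - a)) = 1 - a := by field_simp; ring
  rw [hα, Function.comp_apply]
  have h3 := mul_le_mul_of_nonneg_left hTx (by positivity : 0 ≤ 1 + e)
  have h4 : dist (S (T x)) x ^ 2 ≤ (dist (T x) x + dist (S (T x)) (T x)) ^ 2 :=
    pow_le_pow_left₀ dist_nonneg (by linarith [dist_triangle (S (T x)) (T x) x]) 2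
  have h5 := mul_le_mul_of_nonneg_left h4 (by linarith : 0 ≤ 1 - a)
  have h6 := mul_le_mul_of_nonneg_left
    (h5.trans (harmonic_mul_sq_le (u := dist (T x) x) (v := dist (S (T x)) (T x)) ha0))
    (by positivity : 0 ≤ r / 2)
  have h7 : (1 + e) * (1 + e) * dist x y ^ 2 ≤ (1 + ε) * dist x y ^ 2 := by
    gcongr
    have := mul_le_mul_of_nonneg_left he1 he0.le
    linarith
  have h8 : 0 ≤ e * ((1 - a) / a * (r / 2 * dist (T x) x ^ 2)) := by positivity
  norm_num at hSx
  linarith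

theorem alphaKMAsymp_two (β : ℝ) : alphaKMAsymp 2 β = β / 2 := by
  rw [alphaKMAsymp, show (2 : ℝ) - 1 = 1 by norm_num, Real.rpow_one, sub_self, zero_add]

theorem asympFirmAt_km {κ : ℝ} (hκ : IsCAT κ G) (hG : IsGeodesicSpace G) {r β : ℝ}
    (hr : r ≤ 2) (hβ : β ∈ Ioc (0 : ℝ) 1) {S : G → G} {y : G}
    (hS : ∀ x, IsNearestAlong x (S x) y) :
    AsympFirmAt 2 r (km β S) y (alphaKMAsymp 2 β) := by
  have hβ0 := hβ.1
  have hβ1 := hβ.2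
  rw [alphaKMAsymp_two]
  refine ⟨by linarith, by linarith, fun ε hε => ?_⟩
  obtain ⟨ρ₁, hρ₁, h₁⟩ := hκ.exists_sq_dist_nearest_le hG (half_pos hε)
  -- Half of `ε` pays for `S`. The comparison error is at most `6 d(x,y) ^ 2` times `ε / 12`, the
  -- other half.
  obtain ⟨ρ₂, hρ₂, h₂⟩ := hκ.exists_sq_dist_le (δ := ε / 12) (by positivity)
  refine ⟨_, Metric.closedBall_mem_nhds y (ε := min ρ₁ (ρ₂ / 2)) (by positivity),
    fun x hx => ?_⟩
  have hx' : dist x y ≤ min ρ₁ (ρ₂ / 2) := hx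
  obtain ⟨hx1, hx2⟩ := le_min_iff.1 hx'
  have hSy := (hS y).eq_of_self hG
  rw [firmIneq_two_iff r _ _ x (km_of_fixed hG hβ hSy), dist_km hG hβ]
  have hb := (hS x).dist_le hG
  have hθ : dist (S x) y ≤ 2 * dist x y := by linarith [dist_triangle_left (S x) y x]
  have h3 := h₁ x (S x) y (hS x) hx1
  obtain ⟨γ, hγ, h⟩ := geoComb_spec hG β x (S x)
  have h4 := h₂ y x (S x) γ hγ (by rw [dist_comm]; linarith) (by rw [dist_comm]; linarith)
    (by linarith) β ⟨hβ0.le, hβ1⟩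
  rw [← h, dist_comm y, dist_comm y, dist_comm y, dist_comm x (S x)] at h4
  rw [dist_comm x (S x)] at hb
  have hb2 := pow_le_pow_left₀ dist_nonneg hb 2
  have hθ2 := pow_le_pow_left₀ dist_nonneg hθ 2
  have h5 := mul_le_mul_of_nonneg_left h3 hβ0.le
  have h6 : ε / 12 * (dist x y ^ 2 + dist (S x) y ^ 2 + dist (S x) x ^ 2)
      ≤ ε / 12 * (6 * dist x y ^ 2) := mul_le_mul_of_nonneg_left (by linarith) (by positivity)
  have h7 : (1 - β / 2) / (β / 2) * (r / 2 * (β * dist (S x) x) ^ 2)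
      = r / 2 * ((2 - β) * β * dist (S x) x ^ 2) := by field_simp
  have h8 : r / 2 * ((2 - β) * β * dist (S x) x ^ 2) ≤ 1 * ((2 - β) * β * dist (S x) x ^ 2) := by
    have : 0 ≤ (2 - β) * β * dist (S x) x ^ 2 := by
      have : 0 ≤ 2 - β := by linarith
      positivity
    exact mul_le_mul_of_nonneg_right (by linarith) this
  have h9 : β * (ε / 2 * dist x y ^ 2) ≤ ε / 2 * dist x y ^ 2 :=
    mul_le_of_le_one_left (by positivity) hβ1
  rw [h7, km]
  linarith

end ProxFirm

/-! ### Assembly of the five statements. -/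

theorem proposition4p3 {G : Type*} [MetricSpace G] [CompleteSpace G] (p c : ℝ)
    (hG : ProxFirm.IsPUniformlyConvex p c G) (hc1 : 1 < c) (hc2 : c ≤ 2)
    (f g : G → EReal) (hf : ProxFirm.IsProperConvexLsc f) (hg : ProxFirm.IsProperConvexLsc g)
    (hfg : (ProxFirm.argmin f ∩ ProxFirm.argmin g).Nonempty) :
    -- (i) composition of two proximal mappings
    (∀ l₁ > 0, ∀ l₂ > 0, ∀ y ∈ ProxFirm.argmin f ∩ ProxFirm.argmin g,
      ProxFirm.AlmostFirmAt p c (ProxFirm.prox p l₂ f ∘ ProxFirm.prox p l₁ g) univ y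
        (2 * (c - 1) / (2 * c - 1)) (1 / (c - 1) ^ 2 - 1) ∧
      (p = 2 → ∀ κ > 0, ProxFirm.IsCAT κ G → ∀ c' ∈ Ioc (0 : ℝ) 2,
        ProxFirm.AsympFirmAt p c' (ProxFirm.prox p l₂ f ∘ ProxFirm.prox p l₁ g) y (2 / 3))) ∧
    -- (ii) composition of a proximal mapping with an asymptotically firm mapping
    (∀ l > 0, ∀ (T₀ : G → G) (α₀ : ℝ),
      ((∀ y ∈ ProxFirm.argmin f ∩ Function.fixedPoints T₀, ProxFirm.AsympFirmAt p c T₀ y α₀) →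
        ∀ y ∈ ProxFirm.argmin f ∩ Function.fixedPoints T₀,
          (∀ (D : Set G) (ε₀ : ℝ), ProxFirm.AlmostFirmAt p c T₀ D y α₀ ε₀ →
            ProxFirm.AlmostFirmAt p c (ProxFirm.prox p l f ∘ T₀) D y
              (ProxFirm.alphaComp c α₀ (ProxFirm.alphaC c))
              (ε₀ + ProxFirm.epsC c + ε₀ * ProxFirm.epsC c)) ∧
          (∀ ε₀ > 0, ∃ D ∈ 𝓝 y, ProxFirm.AlmostFirmAt p c T₀ D y α₀ ε₀ ∧
            ProxFirm.AlmostFirmAt p c (ProxFirm.prox p l f ∘ T₀) D y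
              (ProxFirm.alphaComp c α₀ (ProxFirm.alphaC c))
              (ε₀ + ProxFirm.epsC c + ε₀ * ProxFirm.epsC c))) ∧
      (p = 2 → ∀ κ > 0, ProxFirm.IsCAT κ G → ∀ c' ∈ Ioc (0 : ℝ) 2,
        (∀ y ∈ ProxFirm.argmin f ∩ Function.fixedPoints T₀,
          ProxFirm.AsympFirmAt p c' T₀ y α₀) →
        ∀ y ∈ ProxFirm.argmin f ∩ Function.fixedPoints T₀,
          ProxFirm.AsympFirmAt p c' (ProxFirm.prox p l f ∘ T₀) y (1 / (2 - α₀)))) ∧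
    -- (iii) Krasnoselski-Mann relaxation of a proximal mapping
    (∀ l > 0, ∀ β ∈ Ioc (0 : ℝ) 1, ∀ y ∈ ProxFirm.argmin f,
      ProxFirm.AlmostFirmAt p c (ProxFirm.km β (ProxFirm.prox p l f)) univ y
        (ProxFirm.alphaKM p c β) (β * ProxFirm.epsC c) ∧
      (p = 2 → ∀ κ > 0, ProxFirm.IsCAT κ G → ∀ c' ∈ Ioc (0 : ℝ) 2,
        ProxFirm.AsympFirmAt p c' (ProxFirm.km β (ProxFirm.prox p l f)) y
          (ProxFirm.alphaKMAsymp p β))) ∧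
    -- (iv) composition of a proximal mapping with a relaxed proximal mapping
    (∀ l₁ > 0, ∀ l₂ > 0, ∀ β ∈ Ioc (0 : ℝ) 1, ∀ y ∈ ProxFirm.argmin f ∩ ProxFirm.argmin g,
      ProxFirm.AlmostFirmAt p c
        (ProxFirm.prox p l₂ f ∘ ProxFirm.km β (ProxFirm.prox p l₁ g)) univ y
        (ProxFirm.alphaComp c (ProxFirm.alphaKM p c β) (ProxFirm.alphaC c))
        ((1 + β) * ProxFirm.epsC c + β * ProxFirm.epsC c ^ 2) ∧
      (p = 2 → ∀ κ > 0, ProxFirm.IsCAT κ G → ∀ c' ∈ Ioc (0 : ℝ) 2,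
        ProxFirm.AsympFirmAt p c'
          (ProxFirm.prox p l₂ f ∘ ProxFirm.km β (ProxFirm.prox p l₁ g)) y
          (1 / (2 - ProxFirm.alphaKMAsymp p β)))) ∧
    -- (v) projected relaxed proximal mapping
    (∀ C : Set G, IsClosed C → ProxFirm.IsGeodConvex C →
      ∀ l > 0, ∀ β ∈ Ioc (0 : ℝ) 1, ∀ y ∈ C ∩ ProxFirm.argmin g,
      (ProxFirm.IsSymmPerp G →
        ProxFirm.AlmostFirmAt p c
          (ProxFirm.proj C ∘ ProxFirm.km β (ProxFirm.prox p l g)) univ y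
          (1 / (c / 2 * (1 - ProxFirm.alphaKM p c β) + 1)) (ProxFirm.epsC c * β)) ∧
      (p = 2 → ∀ κ > 0, ProxFirm.IsCAT κ G → ∀ c' ∈ Ioc (0 : ℝ) 2,
        ProxFirm.AsympFirmAt p c'
          (ProxFirm.proj C ∘ ProxFirm.km β (ProxFirm.prox p l g)) y
          (1 / (2 - ProxFirm.alphaKMAsymp p β)))) := by
  have hc0 : 0 < c := one_pos.trans hc1
  have hgs := hG.2.2.1
  have fixed : ∀ {S : G → G} {y : G}, (∀ x, ProxFirm.IsNearestAlong x (S x) y) → S y = y :=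
    fun h => (h _).eq_of_self hgs
  refine ⟨fun l₁ hl₁ l₂ hl₂ y hy => ?_, fun l hl T₀ α₀ => ⟨fun hT₀ y hy => ?_, ?_⟩,
    fun l hl β hβ y hy => ?_, fun l₁ hl₁ l₂ hl₂ β hβ y hy => ?_,
    fun C hC hconv l hl β hβ y hy => ?_⟩
  · have hP := ProxFirm.isNearestAlong_prox hG hl₁ hg hy.2
    have hQ := ProxFirm.isNearestAlong_prox hG hl₂ hf hy.1
    refine ⟨?_, ?_⟩
    · convert ProxFirm.almostFirmAt_comp_prox hG hc1 hc2 hl₂ hf hy.1 (fixed hP)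
        (ProxFirm.almostFirmAt_of_isNearestAlong hG hc1 hc2 hP) using 1
      · have h0 := ProxFirm.alphaC_pos hc1
        have h1 := ProxFirm.alphaC_lt_one hc1
        obtain ⟨h2, -, h3⟩ := ProxFirm.div_of_comp_const c h0 h1 h0 h1 hc0
        rw [ProxFirm.one_sub_alphaC_div hc1, div_eq_iff h2.ne'] at h3
        -- Both gains equal `k = 2 / (c (c - 1))`, so the composition has gain `(c / 2) (k / 2)`.
        have h4 : c / 2 * (2 / (c * (c - 1)) * (2 / (c * (c - 1))) /
            (2 / (c * (c - 1)) + 2 / (c * (c - 1)))) = 1 / (2 * (c - 1)) := by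
          have : c - 1 ≠ 0 := by linarith
          field_simp
          norm_num
        rw [h4] at h3
        have h5 : 0 < c - 1 := by linarith
        have h6 : 0 < 2 * c - 1 := by linarith
        rw [div_eq_iff h6.ne']
        field_simp at h3
        linarith
      · have h := ProxFirm.one_add_epsC hc1
        rw [show ProxFirm.epsC c = 1 / (c - 1) - 1 by linarith, ← one_div_pow]
        ring
    · rintro rfl κ - hκ r hr
      rw [show (2 / 3 : ℝ) = 1 / (2 - 1 / 2) by norm_num]
      exact (ProxFirm.asympFirmAt_of_isNearestAlong hκ hgs hr.2 hP).comp hr.1 (fixed hQ)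
        (fixed hP) (ProxFirm.asympFirmAt_of_isNearestAlong hκ hgs hr.2 hQ)
  · refine ⟨fun D ε₀ hT => ProxFirm.almostFirmAt_comp_prox hG hc1 hc2 hl hf hy.1 hy.2 hT,
      fun ε₀ hε₀ => ?_⟩
    obtain ⟨h0, h1, h2⟩ := hT₀ y hy
    obtain ⟨D, hD, hTD⟩ := h2 ε₀ hε₀
    have hT : ProxFirm.AlmostFirmAt p c T₀ D y α₀ ε₀ :=
      ⟨h0, h1, hε₀.le, mem_of_mem_nhds hD, hTD⟩
    exact ⟨D, hD, hT, ProxFirm.almostFirmAt_comp_prox hG hc1 hc2 hl hf hy.1 hy.2 hT⟩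
  · rintro rfl κ - hκ r hr hT y hy
    have hQ := ProxFirm.isNearestAlong_prox hG hl hf hy.1
    exact (hT y hy).comp hr.1 (fixed hQ) hy.2
      (ProxFirm.asympFirmAt_of_isNearestAlong hκ hgs hr.2 hQ)
  · have hQ := ProxFirm.isNearestAlong_prox hG hl hf hy
    refine ⟨(ProxFirm.almostFirmAt_of_isNearestAlong hG hc1 hc2 hQ).km hG hβ (fixed hQ), ?_⟩
    rintro rfl κ - hκ r hr
    exact ProxFirm.asympFirmAt_km hκ hgs hr.2 hβ hQ
  · have hP := ProxFirm.isNearestAlong_prox hG hl₁ hg hy.2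
    have hQ := ProxFirm.isNearestAlong_prox hG hl₂ hf hy.1
    have hK := ProxFirm.km_of_fixed hgs hβ (fixed hP)
    refine ⟨?_, ?_⟩
    · have hKM := ProxFirm.almostFirmAt_comp_prox hG hc1 hc2 hl₂ hf hy.1 hK
        ((ProxFirm.almostFirmAt_of_isNearestAlong hG hc1 hc2 hP).km hG hβ (fixed hP))
      rwa [show β * ProxFirm.epsC c + ProxFirm.epsC c + β * ProxFirm.epsC c * ProxFirm.epsC c
        = (1 + β) * ProxFirm.epsC c + β * ProxFirm.epsC c ^ 2 by ring] at hKM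
    · rintro rfl κ - hκ r hr
      exact (ProxFirm.asympFirmAt_km hκ hgs hr.2 hβ hP).comp hr.1 (fixed hQ) hK
        (ProxFirm.asympFirmAt_of_isNearestAlong hκ hgs hr.2 hQ)
  · have hP := ProxFirm.isNearestAlong_prox hG hl hg hy.2
    have hQ := ProxFirm.isNearestAlong_proj hG hC hconv hy.1
    have hK := ProxFirm.km_of_fixed hgs hβ (fixed hP)
    refine ⟨fun hsymm => ?_, ?_⟩
    · have hKM := (ProxFirm.almostFirmAt_of_isNearestAlong hG hc1 hc2 hP).km hG hβ (fixed hP)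
      have h0 : 0 < ProxFirm.alphaKM p c β := hKM.1
      have h1 : 0 < c / 2 * (1 - ProxFirm.alphaKM p c β) :=
        mul_pos (by linarith) (sub_pos.2 hKM.2.1)
      convert hKM.comp (α := 1 / (c / 2 * (1 - ProxFirm.alphaKM p c β) + 1)) hG (fixed hQ) hK
        (ProxFirm.almostFirmAt_proj hG hsymm hC hconv hy.1) (by positivity)
        ((div_lt_one (by linarith)).2 (by linarith)) ?_ using 1
      · ring
      -- The constant produced by `AlmostFirmAt.km` is `alphaKM` unfolded. The projector contributes
      -- gain `1`, so the harmonic expression becomes `1 - alphaKM p c β`.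
      · change _ = c / 2 * ((1 - ProxFirm.alphaKM p c β) / ProxFirm.alphaKM p c β * _ /
          ((1 - ProxFirm.alphaKM p c β) / ProxFirm.alphaKM p c β + _))
        set a := ProxFirm.alphaKM p c β
        have h2 : (1 - a) / a + (1 - 1 / 2) / (1 / 2) = 1 / a := by field_simp; ring
        rw [h2]
        have h3 : c / 2 * (1 - a) + 1 ≠ 0 := by linarith
        rw [one_sub_div h3, div_div_div_cancel_right₀ h3]
        field_simp
        ring
    · rintro rfl κ - hκ r hr
      exact (ProxFirm.asympFirmAt_km hκ hgs hr.2 hβ hP).comp hr.1 (fixed hQ) hK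
        (ProxFirm.asympFirmAt_of_isNearestAlong hκ hgs hr.2 hQ)
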